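/- Let $n \geq 3$ be an integer and let $X$ be a real normed space of dimension $n$. For a linear subspace $Y \subseteq X$, let $$\lambda(Y, X) = \inf \{ \|P\| : P : X \to Y \text{ bounded linear with } P|_Y = \mathrm{id}_Y \}$$ denote the relative projection constant of $Y$ in $X$. If $X$ has an $(n-1)$-dimensional subspace $Y$ with $\lambda(Y, X) = 2 - \frac{2}{n}$, then $X$ also has a two-dimensional subspace $Z$ with $\lambda(Z, X) = 1$. -/

import Mathlib

/-- The set of projections from `X` onto the subspace `Y`: the continuous linear operators
`P : X → Y` that restrict to the identity on `Y`. -/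
def projectionsOnto {X : Type*} [NormedAddCommGroup X] [NormedSpace ℝ X]
    (Y : Submodule ℝ X) : Set (X →L[ℝ] Y) :=
  {P | ∀ y : Y, P (y : X) = y}

/-- The relative projection constant `λ(Y, X) = inf ‖P‖` over all projections `P` from `X` onto
`Y`, with the operator norm. In finite dimension the set of projections is never empty, and the
norms are bounded below by `0`, so that this is a genuine infimum. -/
noncomputable def relProjConst {X : Type*} [NormedAddCommGroup X] [NormedSpace ℝ X]
    (Y : Submodule ℝ X) : ℝ :=
  sInf ((fun P : X →L[ℝ] Y => ‖P‖) '' projectionsOnto Y)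

/-! Write a minimal projection onto `Y = ker f` as `P = id - f ⊗ u`. By minimality and Carathéodory
there are at most `n` contact pairs `(x i, g i)`, with `g i (P (x i)) = ‖P‖`, and weights making `∑
w i * f (x i) * g i` a multiple `c` of `f` (`exists_contact_weights`). Evaluated at the `x j`, this
gives the matrix `g i (x j)` an eigenvector, and the weighted trace minus `c` is `‖P‖`. Such a
quantity is at most `2 - 2 / n`; after sign changes equality forces diagonal `1` and off-diagonal
`-1` (`bohnenblust_matrix_equality`). For three indices, `g i` and `-g k` then embed the span of `x
i`, `x j` isometrically in the plane with max norm, which is 1-complemented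
(`relProjConst_eq_one_of_dual_system`). -/

/-! ### Equality in the matrix inequality -/

open Finset in
lemma bohnenblust_matrix_equality {ι : Type*} [Fintype ι] [DecidableEq ι] {n : ℕ} (hn : 3 ≤ n)
    (hcard : Fintype.card ι ≤ n) {w a : ι → ℝ} {t : ι → ι → ℝ} {c : ℝ}
    (hw : ∀ i, 0 < w i) (hw1 : ∑ i, w i = 1) (ha : ∀ i, 0 < a i) (ht : ∀ i j, |t i j| ≤ 1)
    (hc : ∀ j, ∑ i, w i * a i * t i j = c * a j)
    (hl : ∑ i, w i * t i i - c = 2 - 2 / (n : ℝ)) :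
    Fintype.card ι = n ∧ (∀ i, t i i = 1) ∧ ∀ i j, i ≠ j → t i j = -1 := by
  have hn' : (3 : ℝ) ≤ n := by exact_mod_cast hn
  have hln : 2 / (n : ℝ) < 1 := by rw [div_lt_one (by linarith)]; linarith
  have hne : Nonempty ι := by
    by_contra h
    rw [not_nonempty_iff] at h
    simp at hw1
  have hnt : Nontrivial ι := by
    by_contra h
    rw [not_nontrivial_iff_subsingleton] at h
    obtain ⟨i⟩ := hne
    have hu : (univ : Finset ι) = {i} := by
      ext j; simp [Subsingleton.elim j i]
    have h2 := hc i
    simp only [hu, sum_singleton] at hw1 hl h2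
    rw [hw1] at hl h2
    have : t i i = c := mul_right_cancel₀ (ha i).ne' (by linarith)
    linarith
  set m : ℝ := (Fintype.card ι : ℝ) with hm
  have hm0 : 0 < m := by rw [hm]; exact_mod_cast Fintype.card_pos
  have hm2 : 2 ≤ m := by rw [hm]; exact_mod_cast Fintype.one_lt_card (α := ι)
  have hmn : m ≤ n := by rw [hm]; exact_mod_cast hcard
  set A := ∑ i, w i * a i with hA
  set S := ∑ i, a i with hS
  have hA0 : 0 < A := sum_pos (fun i _ => mul_pos (hw i) (ha i)) univ_nonempty
  have hS0 : 0 < S := sum_pos (fun i _ => ha i) univ_nonempty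
  -- `e j` is the off-diagonal slack of column `j`; it vanishes iff all its off-diagonal entries are
  -- `-1`.
  set e : ι → ℝ := fun j => ∑ i ∈ univ.erase j, w i * a i * (1 + t i j) with he
  have het : ∀ i j, 0 ≤ w i * a i * (1 + t i j) := fun i j =>
    mul_nonneg (mul_pos (hw i) (ha i)).le (by linarith [(abs_le.1 (ht i j)).1])
  have he0 : ∀ j, 0 ≤ e j := fun j => sum_nonneg fun i _ => het i j
  have hej : ∀ j, -c * a j = A - w j * a j * (1 + t j j) - e j := by
    intro j
    have h1 : ∑ i, w i * a i * (1 + t i j) = A + c * a j := by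
      rw [← hc j, hA, ← sum_add_distrib]
      exact sum_congr rfl fun i _ => by ring
    rw [← add_sum_erase univ _ (mem_univ j)] at h1
    simp only [he]
    linarith
  -- weights for averaging the column identities
  obtain ⟨q, hq0, hqa, hqA⟩ : ∃ q : ι → ℝ, (∀ j, 0 < q j) ∧ ∑ j, q j * a j = 1 ∧
      A * ∑ j, q j - 2 * ∑ j, q j * (w j * a j) ≤ 1 - 2 / m := by
    -- Constant `q` works when the `w`-mean `A` of `a` is at most the plain mean `S / m`; otherwise
    -- take `q` proportional to `w` and use Cauchy–Schwarz.
    rcases le_total (m * A) S with h | h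
    · refine ⟨fun _ => S⁻¹, fun _ => inv_pos.2 hS0, ?_, ?_⟩
      · rw [← mul_sum, inv_mul_cancel₀ hS0.ne']
      · rw [← mul_sum, sum_const, card_univ, nsmul_eq_mul, ← hm, ← hA]
        have h1 : A * (m * S⁻¹) - 2 * (S⁻¹ * A) = (m - 2) * (A / S) := by ring
        have h2 : A / S ≤ 1 / m := by
          rw [div_le_div_iff₀ hS0 hm0]; linarith
        rw [h1]
        calc (m - 2) * (A / S) ≤ (m - 2) * (1 / m) :=
              mul_le_mul_of_nonneg_left h2 (by linarith)
          _ = 1 - 2 / m := by field_simp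
    · refine ⟨fun j => w j / A, fun j => div_pos (hw j) hA0, ?_, ?_⟩
      · have : ∀ j, w j / A * a j = w j * a j / A := fun j => by ring
        simp only [this]
        rw [← sum_div, div_self hA0.ne']
      · rw [← sum_div, hw1]
        have h1 : A ^ 2 ≤ S * ∑ j, w j * (w j * a j) := by
          have := sum_sq_le_sum_mul_sum_of_sq_le_mul univ (r := fun j => w j * a j)
            (f := fun j => a j) (g := fun j => w j * (w j * a j))
            (fun i _ => (ha i).le) (fun i _ => (mul_pos (hw i) (mul_pos (hw i) (ha i))).le)
            (fun i _ => le_of_eq (by ring))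
          simpa using this
        have h0 : 0 ≤ ∑ j, w j * (w j * a j) :=
          sum_nonneg fun i _ => (mul_pos (hw i) (mul_pos (hw i) (ha i))).le
        have h2 : ∀ j, w j / A * (w j * a j) = w j * (w j * a j) / A := fun j => by ring
        simp only [h2]
        rw [← sum_div]
        have h3 : 1 / m ≤ (∑ j, w j * (w j * a j)) / A := by
          rw [div_le_div_iff₀ hm0 hA0, one_mul]
          have h4 : A * A ≤ A * ((∑ j, w j * (w j * a j)) * m) := by nlinarith
          exact le_of_mul_le_mul_left h4 hA0
        have h5 : A * (1 / A) = 1 := by field_simp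
        have h6 : 2 / m = 2 * (1 / m) := by ring
        linarith
  have hq1 : ∀ j, q j * a j < 1 := by
    intro j
    obtain ⟨k, hk⟩ := exists_ne j
    rw [← hqa]
    exact single_lt_sum hk (mem_univ j) (mem_univ k) (mul_pos (hq0 k) (ha k))
      fun i _ _ => (mul_pos (hq0 i) (ha i)).le
  have hb : -c = A * ∑ j, q j - 2 * ∑ j, q j * (w j * a j)
      + ∑ j, w j * (1 - t j j) * (q j * a j) - ∑ j, q j * e j := by
    calc -c = ∑ j, q j * (-c * a j) := by
          have : ∀ j, q j * (-c * a j) = -c * (q j * a j) := fun j => by ring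
          simp only [this]
          rw [← mul_sum, hqa, mul_one]
      _ = _ := by
          rw [mul_sum, mul_sum, ← sum_sub_distrib, ← sum_add_distrib, ← sum_sub_distrib]
          refine sum_congr rfl fun j _ => ?_
          rw [hej]; ring
  have hd0 : ∀ j, 0 ≤ w j * (1 - t j j) * (1 - q j * a j) := fun j =>
    mul_nonneg (mul_nonneg (hw j).le (by linarith [(abs_le.1 (ht j j)).2]))
      (by linarith [hq1 j])
  have hqe0 : ∀ j, 0 ≤ q j * e j := fun j => mul_nonneg (hq0 j).le (he0 j)
  have hD0 := sum_nonneg fun j (_ : j ∈ univ) => hd0 j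
  have hE0 := sum_nonneg fun j (_ : j ∈ univ) => hqe0 j
  have hwt : ∑ j, w j * (1 - t j j) * (1 - q j * a j)
      = 1 - ∑ j, w j * t j j - ∑ j, w j * (1 - t j j) * (q j * a j) := by
    rw [eq_sub_iff_add_eq, eq_sub_iff_add_eq, ← sum_add_distrib, ← sum_add_distrib]
    exact (sum_congr rfl fun j _ => by ring).trans hw1
  -- The left side of `hl` is at most `2 - 2 / m` minus the two nonnegative slack sums, so equality
  -- with `2 - 2 / n` forces `m = n` and both sums to vanish.
  have hmn2 : 2 / (n : ℝ) ≤ 2 / m := div_le_div_of_nonneg_left (by norm_num) hm0 hmn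
  have hmn3 : 2 / (n : ℝ) = 2 / m := by linarith
  have hD : ∑ j, w j * (1 - t j j) * (1 - q j * a j) = 0 := by linarith
  have hE : ∑ j, q j * e j = 0 := by linarith
  refine ⟨?_, fun i => ?_, fun i j hij => ?_⟩
  · have : (n : ℝ) = m := by
      have hn0 : (n : ℝ) ≠ 0 := by linarith
      field_simp at hmn3
      linarith
    rw [hm] at this
    exact_mod_cast this.symm
  · have h := (sum_eq_zero_iff_of_nonneg fun j _ => hd0 j).1 hD i (mem_univ i)
    have h1 : 1 - q i * a i ≠ 0 := by linarith [hq1 i]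
    have h2 : 1 - t i i = 0 := by simpa [h1, (hw i).ne'] using h
    linarith
  · have h := (sum_eq_zero_iff_of_nonneg fun j _ => hqe0 j).1 hE j (mem_univ j)
    have h1 : e j = 0 := by simpa [(hq0 j).ne'] using h
    have h2 := (sum_eq_zero_iff_of_nonneg fun i _ => het i j).1 h1 i (by simp [hij])
    have h3 : 1 + t i j = 0 := by simpa [(hw i).ne', (ha i).ne'] using h2
    linarith

/-! ### Contact pairs of a minimal projection -/

/-- By Carathéodory the hull is a continuous image of a simplex times a power of `s`. -/
lemma IsCompact.isCompact_convexHull_of_finiteDimensional {E : Type*} [NormedAddCommGroup E]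
    [NormedSpace ℝ E] [FiniteDimensional ℝ E] {s : Set E} (hs : IsCompact s) :
    IsCompact (convexHull ℝ s) := by
  set d := Module.finrank ℝ E + 1
  have hK : IsCompact (stdSimplex ℝ (Fin d) ×ˢ Set.pi Set.univ fun _ : Fin d => s) :=
    (isCompact_stdSimplex ℝ (Fin d)).prod (isCompact_univ_pi fun _ => hs)
  have hf : Continuous fun p : (Fin d → ℝ) × (Fin d → E) => ∑ i, p.1 i • p.2 i := by fun_prop
  convert hK.image hf
  ext x
  constructor
  · intro hx
    obtain ⟨ι, _, z, w, hz, hai, hw, hw1, hx⟩ := eq_pos_convex_span_of_mem_convexHull hx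
    have hne : Nonempty ι := by
      by_contra h
      rw [not_nonempty_iff] at h
      simp at hw1
    obtain ⟨e⟩ : Nonempty (ι ↪ Fin d) := Function.Embedding.nonempty_of_card_le <| by
      rw [Fintype.card_fin]
      exact hai.card_le_finrank_succ.trans (Nat.succ_le_succ (Submodule.finrank_le _))
    obtain ⟨i₀⟩ := hne
    have hout : ∀ k ∉ Set.range e, Function.extend e w 0 k = 0 := fun k hk => by
      rw [Function.extend_apply' _ _ _ (fun ⟨a, ha⟩ => hk ⟨a, ha⟩)]; rfl
    -- Shorter combinations are padded with weight `0` at the point `z i₀`, which lies in `s`.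
    refine ⟨(Function.extend e w 0, Function.extend e z fun _ => z i₀), ⟨⟨fun k => ?_, ?_⟩, ?_⟩, ?_⟩
    · by_cases hk : k ∈ Set.range e
      · obtain ⟨i, rfl⟩ := hk
        simp only [e.injective.extend_apply]
        exact (hw i).le
      · exact (hout k hk).ge
    · rw [← hw1]
      exact (Fintype.sum_of_injective e e.injective _ _ hout
        fun i => (e.injective.extend_apply _ _ _).symm).symm
    · intro k _
      by_cases hk : k ∈ Set.range e
      · obtain ⟨i, rfl⟩ := hk
        simp only [e.injective.extend_apply]
        exact hz ⟨i, rfl⟩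
      · simp only [Function.extend_apply' _ _ _ (fun ⟨a, ha⟩ => hk ⟨a, ha⟩)]
        exact hz ⟨i₀, rfl⟩
    · rw [← hx]
      refine (Fintype.sum_of_injective e e.injective _ _ (fun k hk => ?_) fun i => ?_).symm
      · simp only [hout k hk, zero_smul]
      · simp only [e.injective.extend_apply]
  · rintro ⟨⟨w, z⟩, ⟨⟨hw, hw1⟩, hz⟩, rfl⟩
    exact (convex_convexHull ℝ s).sum_mem (fun i _ => hw i) hw1
      fun i _ => subset_convexHull ℝ s (hz i (Set.mem_univ i))

section

variable {X : Type*} [NormedAddCommGroup X] [NormedSpace ℝ X]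

lemma exists_norm_eq_dual_apply [FiniteDimensional ℝ X] {F : Type*} [NormedAddCommGroup F]
    [NormedSpace ℝ F] (Q : X →L[ℝ] F) :
    ∃ (x : X) (g : StrongDual ℝ F), ‖x‖ ≤ 1 ∧ ‖g‖ ≤ 1 ∧ g (Q x) = ‖Q‖ := by
  have : ProperSpace X := FiniteDimensional.proper ℝ X
  obtain ⟨x, hx, hmax⟩ := (isCompact_closedBall (0 : X) 1).exists_isMaxOn
    ⟨0, by simp⟩ (f := fun x => ‖Q x‖) (by fun_prop)
  obtain ⟨g, hg, hgx⟩ := exists_dual_vector'' ℝ (Q x)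
  refine ⟨x, g, by simpa using hx, hg, ?_⟩
  rw [hgx, RCLike.ofReal_real_eq_id, id]
  refine le_antisymm ?_ ?_
  · exact Q.unit_le_opNorm x (by simpa using hx)
  · refine Q.opNorm_le_of_unit_norm (norm_nonneg _) fun y hy => ?_
    exact hmax (show y ∈ Metric.closedBall 0 1 by simp [hy])

lemma exists_pos_of_zero_notMem_convexHull {E : Type*} [NormedAddCommGroup E] [NormedSpace ℝ E]
    [FiniteDimensional ℝ E] {s : Set E} (hs : IsCompact s) (h0 : (0 : E) ∉ convexHull ℝ s) :
    ∃ F : StrongDual ℝ E, ∀ x ∈ s, 0 < F x := by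
  obtain ⟨F, u, hu, hF⟩ := geometric_hahn_banach_point_closed (convex_convexHull ℝ s)
    hs.isCompact_convexHull_of_finiteDimensional.isClosed h0
  rw [map_zero] at hu
  exact ⟨F, fun x hx => hu.trans (hF _ (subset_convexHull ℝ _ hx))⟩

/-- By reflexivity the separating functional is evaluation at a point. -/
lemma exists_pos_of_zero_notMem_convexHull_dual [FiniteDimensional ℝ X]
    {s : Set (StrongDual ℝ X)} (hs : IsCompact s) (h0 : (0 : StrongDual ℝ X) ∉ convexHull ℝ s) :
    ∃ y : X, ∀ g ∈ s, 0 < g y := by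
  obtain ⟨F, hF⟩ := exists_pos_of_zero_notMem_convexHull hs h0
  obtain ⟨y, hy⟩ := (Module.evalEquiv ℝ X).surjective
    (F.toLinearMap ∘ₗ (LinearMap.toContinuousLinearMap (E := X) (F' := ℝ)).toLinearMap)
  refine ⟨y, fun g hg => ?_⟩
  have h : g y = F g := LinearMap.congr_fun hy g.toLinearMap
  rw [h]
  exact hF g hg

/-- Contact pairs of an operator that is best approximated by zero among the rank-one operators
`f ⊗ y`, `y ∈ Y`. -/
lemma exists_contact_weights [FiniteDimensional ℝ X] (Y : Submodule ℝ X) (P : X →L[ℝ] X)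
    (f : StrongDual ℝ X) (hP : ∀ y ∈ Y, ‖P‖ ≤ ‖P - f.smulRight y‖) :
    ∃ (ι : Type) (_ : Fintype ι) (w : ι → ℝ) (x : ι → X) (g : ι → StrongDual ℝ X),
      Fintype.card ι ≤ Module.finrank ℝ Y + 1 ∧ (∀ i, 0 < w i) ∧ ∑ i, w i = 1 ∧
      (∀ i, ‖x i‖ ≤ 1) ∧ (∀ i, ‖g i‖ ≤ 1) ∧ (∀ i, g i (P (x i)) = ‖P‖) ∧
      ∀ y ∈ Y, ∑ i, w i * f (x i) * g i y = 0 := by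
  have : ProperSpace X := FiniteDimensional.proper ℝ X
  have : ProperSpace (StrongDual ℝ X) := FiniteDimensional.proper ℝ _
  set B : Set (X × StrongDual ℝ X) := Metric.closedBall 0 1 ×ˢ Metric.closedBall 0 1 with hB
  have hBc : IsCompact B := (isCompact_closedBall _ _).prod (isCompact_closedBall _ _)
  have happ : Continuous fun p : X × StrongDual ℝ X => p.2 (P p.1) := by fun_prop
  set C : Set (X × StrongDual ℝ X) := B ∩ {p | p.2 (P p.1) = ‖P‖} with hC
  have hCc : IsCompact C := hBc.inter_right (isClosed_eq happ continuous_const)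
  let φ : X × StrongDual ℝ X → StrongDual ℝ Y := fun p => f p.1 • p.2.comp Y.subtypeL
  have hφ : Continuous φ := (f.continuous.comp continuous_fst).smul
    ((ContinuousLinearMap.precomp ℝ Y.subtypeL).continuous.comp continuous_snd)
  have hφa : ∀ p y, φ p y = f p.1 * p.2 y := fun p y => rfl
  have hle : ∀ p ∈ B, p.2 (P p.1) ≤ ‖P‖ := by
    rintro ⟨x, g⟩ ⟨hx, hg⟩
    simp only [Metric.mem_closedBall, dist_zero_right] at hx hg
    calc g (P x) ≤ ‖g (P x)‖ := le_abs_self _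
      _ ≤ ‖P x‖ := by simpa using g.le_of_opNorm_le hg (P x)
      _ ≤ ‖P‖ := P.unit_le_opNorm x hx
  -- Otherwise some `y` has `f x * g y > 0` on all contact pairs, and subtracting a small multiple
  -- of `f ⊗ y` lowers the norm: pairs with a positive product decrease, while the others, forming
  -- the compact set `D`, stay `δ` below `‖P‖`. The step `δ / M` raises them by less than `δ`.
  have h0 : (0 : StrongDual ℝ Y) ∈ convexHull ℝ (φ '' C) := by
    by_contra h0
    obtain ⟨y, hy⟩ := exists_pos_of_zero_notMem_convexHull_dual (hCc.image hφ) h0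
    have hpos : ∀ p ∈ C, 0 < f p.1 * p.2 y := fun p hp => hy _ ⟨p, hp, rfl⟩
    have hprod : Continuous fun p : X × StrongDual ℝ X => f p.1 * p.2 y := by fun_prop
    set D : Set (X × StrongDual ℝ X) := B ∩ {p | f p.1 * p.2 y ≤ 0} with hD
    have hDc : IsCompact D := hBc.inter_right (isClosed_le hprod continuous_const)
    have h0D : (0 : X × StrongDual ℝ X) ∈ D := by simp [hD, hB]
    obtain ⟨p₀, hp₀, hmax⟩ := hDc.exists_isMaxOn ⟨0, h0D⟩ happ.continuousOn
    have hlt : p₀.2 (P p₀.1) < ‖P‖ := by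
      refine lt_of_le_of_ne (hle p₀ hp₀.1) fun h => ?_
      exact absurd (hpos p₀ ⟨hp₀.1, h⟩) (not_lt.2 hp₀.2)
    obtain ⟨p₁, hp₁, hmin⟩ := hDc.exists_isMinOn ⟨0, h0D⟩ hprod.continuousOn
    set δ := ‖P‖ - p₀.2 (P p₀.1) with hδ
    have hδ0 : 0 < δ := by linarith
    set M := 1 - f p₁.1 * p₁.2 y with hM
    have hM0 : 0 < M := by have : f p₁.1 * p₁.2 y ≤ 0 := hp₁.2; linarith
    obtain ⟨x, g, hx, hg, hxg⟩ := exists_norm_eq_dual_apply (P - f.smulRight ((δ / M) • (y : X)))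
    have hge := hP ((δ / M) • (y : X)) (Y.smul_mem _ y.2)
    rw [← hxg] at hge
    simp only [sub_apply, ContinuousLinearMap.smulRight_apply, map_sub,
      map_smul, smul_eq_mul] at hge
    have hmem : (x, g) ∈ B := by simp [hB, hx, hg]
    have hr : 0 < δ / M := div_pos hδ0 hM0
    rcases lt_or_ge 0 (f x * g y) with h | h
    · have h1 := hle _ hmem
      have h2 := mul_pos hr h
      simp only at h1
      linarith
    · have hxD : (x, g) ∈ D := ⟨hmem, h⟩
      have h1 : g (P x) ≤ p₀.2 (P p₀.1) := hmax hxD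
      have h2 : f p₁.1 * p₁.2 y ≤ f x * g y := hmin hxD
      have h3 : -(f x * g y) < M := by linarith
      have h4 := mul_lt_mul_of_pos_left h3 hr
      rw [div_mul_cancel₀ _ hM0.ne'] at h4
      linarith
  obtain ⟨ι, _, z, w, hz, hai, hw, hw1, hsum⟩ := eq_pos_convex_span_of_mem_convexHull h0
  choose p hpC hpz using fun i => hz ⟨i, rfl⟩
  let e := Fintype.equivFin ι
  have hcard : Fintype.card ι ≤ Module.finrank ℝ Y + 1 := by
    refine hai.card_le_finrank_succ.trans (Nat.succ_le_succ ?_)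
    refine (Submodule.finrank_le _).trans_eq ?_
    rw [← (LinearMap.toContinuousLinearMap (E := Y) (F' := ℝ) (𝕜 := ℝ)).finrank_eq]
    exact Subspace.dual_finrank_eq
  refine ⟨Fin (Fintype.card ι), inferInstance, w ∘ e.symm, fun i => (p (e.symm i)).1,
    fun i => (p (e.symm i)).2, by simpa using hcard, fun i => hw _, ?_, fun i => ?_, fun i => ?_,
    fun i => (hpC _).2, fun y hy => ?_⟩
  · rw [← hw1]; exact e.symm.sum_comp w
  · simpa using (hpC (e.symm i)).1.1
  · simpa using (hpC (e.symm i)).1.2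
  · have h1 := DFunLike.congr_fun hsum ⟨y, hy⟩
    refine (e.symm.sum_comp fun i => w i * f (p i).1 * (p i).2 y).trans ?_
    simp only [sum_apply, smul_apply, ← hpz, hφa,
      smul_eq_mul, zero_apply] at h1
    simpa only [mul_assoc] using h1

/-! ### Planes of projection constant one -/

/-- The norm bound is `|α + β| / 2 + |α - β| / 2 = max |α| |β|`, with `α = g₂ x` and `β = g₁ x`. -/
lemma relProjConst_eq_one_of_dual_system {x₁ x₂ : X} {g₁ g₂ : StrongDual ℝ X}
    (hx₁ : ‖x₁‖ ≤ 1) (hx₂ : ‖x₂‖ ≤ 1) (hg₁ : ‖g₁‖ ≤ 1) (hg₂ : ‖g₂‖ ≤ 1)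
    (h₁₁ : g₁ x₁ = 1) (h₁₂ : g₁ x₂ = -1) (h₂₁ : g₂ x₁ = 1) (h₂₂ : g₂ x₂ = 1) :
    Module.finrank ℝ (Submodule.span ℝ {x₁, x₂}) = 2 ∧
      relProjConst (Submodule.span ℝ {x₁, x₂}) = 1 := by
  set Z := Submodule.span ℝ {x₁, x₂}
  have hm₁ : x₁ ∈ Z := Submodule.subset_span (by simp)
  have hm₂ : x₂ ∈ Z := Submodule.subset_span (by simp)
  have hli : LinearIndependent ℝ ![x₁, x₂] := by
    rw [LinearIndependent.pair_iff]
    intro s t h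
    have e₁ := congrArg g₁ h
    have e₂ := congrArg g₂ h
    simp [h₁₁, h₁₂, h₂₁, h₂₂] at e₁ e₂
    constructor <;> linarith
  have hx₁0 : x₁ ≠ 0 := by rintro rfl; simp at h₁₁
  constructor
  · have := finrank_span_eq_card hli
    rwa [Matrix.range_cons_cons_empty, Fintype.card_fin] at this
  let P : X →L[ℝ] Z := ((1 / 2 : ℝ) • (g₂ + g₁)).smulRight ⟨x₁, hm₁⟩ +
    ((1 / 2 : ℝ) • (g₂ - g₁)).smulRight ⟨x₂, hm₂⟩
  have hPa : ∀ x, (P x : X) = (1 / 2 * (g₂ x + g₁ x)) • x₁ + (1 / 2 * (g₂ x - g₁ x)) • x₂ :=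
    fun x => rfl
  have hP : P ∈ projectionsOnto Z := by
    intro z
    obtain ⟨s, t, hst⟩ := Submodule.mem_span_pair.1 z.2
    apply Subtype.ext
    rw [hPa, ← hst]
    simp only [map_add, map_smul, h₁₁, h₁₂, h₂₁, h₂₂, smul_eq_mul]
    congr 2 <;> ring
  have hnorm : ‖P‖ ≤ 1 := by
    refine P.opNorm_le_bound zero_le_one fun x => ?_
    have b₁ : |g₁ x| ≤ ‖x‖ := by simpa using g₁.le_of_opNorm_le hg₁ x
    have b₂ : |g₂ x| ≤ ‖x‖ := by simpa using g₂.le_of_opNorm_le hg₂ x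
    rw [one_mul, Submodule.coe_norm, hPa]
    calc _ ≤ |1 / 2 * (g₂ x + g₁ x)| * ‖x₁‖ + |1 / 2 * (g₂ x - g₁ x)| * ‖x₂‖ := by
          refine (norm_add_le _ _).trans (le_of_eq ?_)
          rw [norm_smul, norm_smul]; rfl
      _ ≤ |1 / 2 * (g₂ x + g₁ x)| * 1 + |1 / 2 * (g₂ x - g₁ x)| * 1 := by gcongr
      _ ≤ ‖x‖ := by
          rw [abs_le] at b₁ b₂
          rcases abs_cases (1 / 2 * (g₂ x + g₁ x)) with h | h <;>
          rcases abs_cases (1 / 2 * (g₂ x - g₁ x)) with h' | h' <;> linarith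
  refine IsLeast.csInf_eq ⟨⟨P, hP, ?_⟩, ?_⟩
  · refine le_antisymm hnorm ?_
    have h := P.le_opNorm x₁
    have h' : P x₁ = ⟨x₁, hm₁⟩ := hP ⟨x₁, hm₁⟩
    rw [h'] at h
    exact le_of_mul_le_mul_right (by simpa using h) (norm_pos_iff.2 hx₁0)
  · rintro _ ⟨Q, hQ, rfl⟩
    have h := Q.le_opNorm x₁
    have h' : Q x₁ = ⟨x₁, hm₁⟩ := hQ ⟨x₁, hm₁⟩
    rw [h'] at h
    exact le_of_mul_le_mul_right (by simpa using h) (norm_pos_iff.2 hx₁0)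

lemma relProjConst_le {Y : Submodule ℝ X} {Q : X →L[ℝ] Y} (hQ : Q ∈ projectionsOnto Y) :
    relProjConst Y ≤ ‖Q‖ :=
  csInf_le ⟨0, by rintro _ ⟨R, -, rfl⟩; exact norm_nonneg R⟩ ⟨Q, hQ, rfl⟩

lemma exists_norm_eq_relProjConst [FiniteDimensional ℝ X] (Y : Submodule ℝ X) :
    ∃ P ∈ projectionsOnto Y, ‖P‖ = relProjConst Y := by
  have : ProperSpace (X →L[ℝ] Y) := FiniteDimensional.proper ℝ (X →L[ℝ] Y)
  have hcl : IsClosed (projectionsOnto Y) := by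
    simp only [projectionsOnto, Set.ofPred_forall]
    exact isClosed_iInter fun y => isClosed_eq (by fun_prop) continuous_const
  have hne : (projectionsOnto Y).Nonempty := by
    obtain ⟨Z, hZ⟩ := Submodule.exists_isCompl Y
    exact ⟨LinearMap.toContinuousLinearMap (Y.projectionOnto Z hZ),
      Submodule.projectionOnto_apply_left hZ⟩
  obtain ⟨P, hP, hd⟩ := hcl.exists_infDist_eq_dist hne 0
  have hdist : ∀ R : X →L[ℝ] Y, dist 0 R = ‖R‖ := fun R => dist_zero_left R
  refine ⟨P, hP, Eq.symm ?_⟩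
  refine IsLeast.csInf_eq ⟨⟨P, hP, rfl⟩, ?_⟩
  rintro _ ⟨Q, hQ, rfl⟩
  have := Metric.infDist_le_dist_of_mem (x := 0) hQ
  rwa [hd, hdist, hdist] at this

end

/-! ### The main theorem -/

theorem corollary2p7 {X : Type*} [NormedAddCommGroup X] [NormedSpace ℝ X]
    (n : ℕ) (hn : 3 ≤ n) (hX : Module.finrank ℝ X = n)
    (hY : ∃ Y : Submodule ℝ X, Module.finrank ℝ Y = n - 1 ∧
      relProjConst Y = 2 - 2 / (n : ℝ)) :
    ∃ Z : Submodule ℝ X, Module.finrank ℝ Z = 2 ∧ relProjConst Z = 1 := by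
  obtain ⟨Y, hYn, hYl⟩ := hY
  have : FiniteDimensional ℝ X := FiniteDimensional.of_finrank_pos (by omega)
  have hlt : Y < ⊤ := lt_top_iff_ne_top.2 fun h => by
    rw [h, finrank_top] at hYn; omega
  obtain ⟨f₀, hf₀, hYf⟩ := Submodule.exists_le_ker_of_lt_top Y hlt
  have hker : Y = f₀.ker := Submodule.eq_of_le_of_finrank_eq hYf <| by
    have := Module.Dual.finrank_ker_add_one_of_ne_zero hf₀
    omega
  set f : StrongDual ℝ X := LinearMap.toContinuousLinearMap f₀
  have hfY : ∀ z, z ∈ Y ↔ f z = 0 := fun z => by rw [hker]; rfl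
  obtain ⟨v, hv⟩ : ∃ v, f v = 1 := by
    obtain ⟨v, hv⟩ : ∃ v, f₀ v ≠ 0 := by
      by_contra! h
      exact hf₀ (LinearMap.ext h)
    exact ⟨(f₀ v)⁻¹ • v, by simp [f, hv]⟩
  obtain ⟨P₀, hP₀, hnorm⟩ := exists_norm_eq_relProjConst Y
  have hcomp : ∀ Q : X →L[ℝ] Y, ‖Y.subtypeL.comp Q‖ = ‖Q‖ :=
    fun Q => Y.subtypeₗᵢ.norm_toContinuousLinearMap_comp
  set P : X →L[ℝ] X := Y.subtypeL.comp P₀ with hPdef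
  have hPY : ∀ y ∈ Y, P y = y := fun y hy => congrArg Subtype.val (hP₀ ⟨y, hy⟩)
  have hPmem : ∀ z, P z ∈ Y := fun z => (P₀ z).2
  have hPn : ‖P‖ = 2 - 2 / (n : ℝ) := by rw [hPdef, hcomp, hnorm, hYl]
  obtain ⟨u, hP⟩ : ∃ u, ∀ z, P z = z - f z • u := ⟨v - P v, fun z => by
    have h := hPY (z - f z • v) ((hfY _).2 (by simp [hv]))
    rw [map_sub, map_smul, sub_eq_iff_eq_add] at h
    rw [h, smul_sub]
    abel⟩
  -- Since `f` vanishes on `Y`, subtracting `f ⊗ y` from a projection leaves a projection, so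
  -- minimality applies.
  obtain ⟨ι, _, w, x, g, hcard, hw, hw1, hx, hg, hgP, hsum⟩ :=
    exists_contact_weights Y P f fun y hy => by
      have hQ : P₀ - f.smulRight (⟨y, hy⟩ : Y) ∈ projectionsOnto Y := fun z => by
        have : f z = 0 := (hfY _).1 z.2
        simp [this, hP₀ z]
      have := relProjConst_le hQ
      rw [hPdef, hcomp, hnorm]
      refine this.trans_eq ?_
      rw [← hcomp]
      rfl
  have hn' : (3 : ℝ) ≤ n := by exact_mod_cast hn
  have hln : 2 / (n : ℝ) < 1 := by rw [div_lt_one (by linarith)]; linarith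
  have hgx : ∀ i j, |g i (x j)| ≤ 1 := fun i j =>
    (g i).unit_le_opNorm (x j) (hx j) |>.trans (hg i)
  -- If `f (x i) = 0` then `P` fixes `x i` and `‖P‖ = g i (x i) ≤ 1`, but `2 - 2 / n > 1`.
  have hfx : ∀ i, f (x i) ≠ 0 := fun i h => by
    have h1 := hgP i
    rw [hP, h, zero_smul, sub_zero, hPn] at h1
    linarith [(abs_le.1 (hgx i i)).2]
  -- normalise signs so that `f` is positive on all contact vectors
  set ε : ι → ℝ := fun i => SignType.sign (f (x i)) with hε
  have hεε : ∀ i, ε i * ε i = 1 := fun i => by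
    rcases lt_or_gt_of_ne (hfx i) with h | h <;> simp [hε, h]
  have hεa : ∀ i, |ε i| = 1 := fun i => by
    rcases lt_or_gt_of_ne (hfx i) with h | h <;> simp [hε, h]
  have hεf : ∀ i, 0 < ε i * f (x i) := fun i => by
    rcases lt_or_gt_of_ne (hfx i) with h | h <;> simp [hε, h]
  set c := ∑ i, w i * f (x i) * g i u with hc
  have hcz : ∀ z, ∑ i, w i * f (x i) * g i z = c * f z := fun z => by
    have h := hsum _ (hPmem z)
    rw [hP] at h
    rw [hc, Finset.sum_mul, ← sub_eq_zero, ← Finset.sum_sub_distrib, ← h]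
    refine Finset.sum_congr rfl fun i _ => ?_
    rw [map_sub, map_smul, smul_eq_mul]
    ring
  classical
  obtain ⟨hcn, hdiag, hoff⟩ := bohnenblust_matrix_equality hn (hcard.trans (by omega)) hw hw1
    (a := fun i => ε i * f (x i)) (t := fun i j => ε i * ε j * g i (x j)) (c := c) hεf
    (fun i j => by rw [abs_mul, abs_mul, hεa, hεa, one_mul, one_mul]; exact hgx i j)
    (fun j => by
      rw [mul_left_comm, ← hcz, Finset.mul_sum]
      refine Finset.sum_congr rfl fun i _ => ?_
      linear_combination w i * f (x i) * ε j * g i (x j) * hεε i)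
    (by
      rw [← hPn, ← one_mul ‖P‖, ← hw1, Finset.sum_mul, hc, ← Finset.sum_sub_distrib]
      refine Finset.sum_congr rfl fun i _ => ?_
      rw [← hgP i, hP, map_sub, map_smul, smul_eq_mul]
      linear_combination w i * g i (x i) * hεε i)
  obtain ⟨i, j, k, hij, hik, hjk⟩ := Fintype.two_lt_card_iff.1 (show 2 < Fintype.card ι by omega)
  have hnx : ∀ i, ‖ε i • x i‖ ≤ 1 := fun i => by
    rw [norm_smul, Real.norm_eq_abs, hεa, one_mul]; exact hx i
  have hng : ∀ i, ‖ε i • g i‖ ≤ 1 := fun i => by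
    rw [norm_smul, Real.norm_eq_abs, hεa, one_mul]; exact hg i
  have happ : ∀ i j, (ε i • g i) (ε j • x j) = ε i * ε j * g i (x j) := fun i j => by
    simp only [smul_apply, map_smul, smul_eq_mul]
    ring
  exact ⟨_, relProjConst_eq_one_of_dual_system (hnx i) (hnx j) (hng i)
    (g₂ := -(ε k • g k)) (by rw [norm_neg]; exact hng k)
    (by rw [happ]; exact hdiag i) (by rw [happ]; exact hoff i j hij)
    (by rw [neg_apply, happ, hoff k i hik.symm, neg_neg])
    (by rw [neg_apply, happ, hoff k j hjk.symm, neg_neg])⟩
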